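/- For $n,k\ge 0$ and a pattern $\alpha\in S_3$, let $s_n^k(\alpha)$ be the number of permutations $\pi\in S_n$ with exactly $k$ fixed points that avoid $\alpha$, i.e. such that there are no indices $i_1<i_2<i_3$ for which $\pi_{i_1}\pi_{i_2}\pi_{i_3}$ is order-isomorphic to $\alpha$. For $h>0$, two patterns $\alpha,\beta\in S_3$ are called $h$-Wilf equivalent if $s_n^h(\alpha)=s_n^h(\beta)$ for all $n\ge \max(3,h)$; the equivalence classes are the $h$-Wilf classes of patterns of length $3$. For every integer $h>0$ there are exactly three $h$-Wilf classes of patterns of length $3$, namely $\{123\}$, $\{132,213,321\}$ and $\{231,312\}$; moreover, for all $n\ge 0$, $$s_n^h(132)=s_n^h(213)=s_n^h(321)\quad\text{and}\quad s_n^h(231)=s_n^h(312).$$ Furthermore, $$s_5^1(123)=20,\quad s_5^1(231)=16,\quad s_5^1(132)=13,\qquad s_5^2(123)=2,\quad s_5^2(231)=8,\quad s_5^2(132)=6,$$ and for every $h\ge 3$: $s_n^h(123)=0$ for all $n\ge 0$, $s_{h+2}^h(132)=h+1$, and $s_{h+2}^h(312)\ge 2h+1$. -/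

import Mathlib

namespace PatternAvoid

open Equiv

/-- `π ∈ S_n` contains the pattern `α ∈ S_m`: some subsequence `π_{i_1} ⋯ π_{i_m}`,
`i_1 < ⋯ < i_m`, is order-isomorphic to the word `α_1 ⋯ α_m`. -/
def Contains {n m : ℕ} (π : Perm (Fin n)) (α : Perm (Fin m)) : Prop :=
  ∃ i : Fin m → Fin n, StrictMono i ∧ ∀ a b : Fin m, π (i a) < π (i b) ↔ α a < α b

/-- The number of fixed points of `π`. -/
def numFixed {n : ℕ} (π : Perm (Fin n)) : ℕ :=
  (Finset.univ.filter fun i => π i = i).card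

/-- `S_n^k(T)`: permutations of length `n` with exactly `k` fixed points that avoid every
pattern in `T ⊆ S_m`. -/
def avoidSet (n k : ℕ) {m : ℕ} (T : Set (Perm (Fin m))) : Set (Perm (Fin n)) :=
  {π | (∀ α ∈ T, ¬ Contains π α) ∧ numFixed π = k}

/-- `s_n^k(T) = |S_n^k(T)|`. -/
noncomputable def s (n k : ℕ) {m : ℕ} (T : Set (Perm (Fin m))) : ℕ :=
  (avoidSet n k T).ncard

/-- `h`-Wilf equivalence of sets of patterns of length `m`. -/
def HWilfEquiv (h : ℕ) {m : ℕ} (T₁ T₂ : Set (Perm (Fin m))) : Prop :=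
  ∀ n : ℕ, m ≤ n → h ≤ n → s n h T₁ = s n h T₂

/-- `h`-Wilf equivalence of single patterns of length `m`; its equivalence classes are the
`h`-Wilf classes of patterns of length `m`. -/
def hWilf (h m : ℕ) : Setoid (Perm (Fin m)) where
  r α β := HWilfEquiv h {α} {β}
  iseqv :=
    { refl := fun _ _ _ _ => rfl
      symm := fun H n hm hn => (H n hm hn).symm
      trans := fun H₁ H₂ n hm hn => (H₁ n hm hn).trans (H₂ n hm hn) }

/-! The patterns of length 3; `Fin 3 = {0, 1, 2}` stands for `{1, 2, 3}`. The first vector of each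
definition is the one-line notation, the second that of the inverse. -/

def p123 : Perm (Fin 3) := ⟨![0, 1, 2], ![0, 1, 2], by decide, by decide⟩
def p132 : Perm (Fin 3) := ⟨![0, 2, 1], ![0, 2, 1], by decide, by decide⟩
def p213 : Perm (Fin 3) := ⟨![1, 0, 2], ![1, 0, 2], by decide, by decide⟩
def p231 : Perm (Fin 3) := ⟨![1, 2, 0], ![2, 0, 1], by decide, by decide⟩
def p312 : Perm (Fin 3) := ⟨![2, 0, 1], ![1, 2, 0], by decide, by decide⟩
def p321 : Perm (Fin 3) := ⟨![2, 1, 0], ![2, 1, 0], by decide, by decide⟩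

end PatternAvoid

/-! Inversion preserves fixed points and exchanges 231 with 312; reverse-complement does so for 132
and 213. The substantial identity is 132 versus 321. For both patterns, count avoiders of length n+1
with at least k+1 fixed points by marking the fixed point i that has exactly k fixed points below
it. Both counts satisfy the same renewal recurrence: the sum over j ≤ n of (avoiders of length j
with exactly k fixed points) times (all avoiders of length n-j).

For 321 (`card_marked_p321`), a fixed point splits the permutation into a direct sum, so j = i. For
132 (`card_block_p132`), the entries to the left of and below i occupy a square block [r,i) on the
diagonal, which contains all k earlier fixed points. Deleting the block and i leaves a 132-avoider
of length n-(i-r) with "corner" r. Every 132-avoider has exactly one corner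
(`existsUnique_isCorner`), so summing over r with j = i-r fixed gives all avoiders of length n-j.

The recurrence determines the distribution once the total counts agree (`s_eq_of_recurrence`). They
do: 132 and 213 by reverse-complement, 213 and 123 by isomorphic generating trees (insertion of the
maximum), 123 and 321 by reversal.

To separate the three classes, n = 5 works for h = 1, 2 by computation. For h ≥ 3 take n = h+2:
three fixed points already form a 123, and the permutations with h fixed points are the
transpositions, of which h+1 avoid 132 and at least 2h+1 avoid 312. -/

namespace PatternAvoid

open Equiv

/-! ### Patterns and fixed points over arbitrary linear orders -/

section General

variable {X Y : Type*} [LinearOrder X] [LinearOrder Y]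

/-- Pattern containment for permutations of an arbitrary linear order. -/
def HasPattern {m : ℕ} (α : Perm (Fin m)) (π : Perm X) : Prop :=
  ∃ i : Fin m → X, StrictMono i ∧ ∀ a b : Fin m, π (i a) < π (i b) ↔ α a < α b

/-- The number of fixed points of a permutation of an arbitrary type. -/
noncomputable def fixCount {X : Type*} (π : Perm X) : ℕ := Nat.card {x // π x = x}

/-- The number of permutations of `Fin n` that avoid `α`. -/
noncomputable def avoidCount {m : ℕ} (α : Perm (Fin m)) (n : ℕ) : ℕ :=
  Nat.card {π : Perm (Fin n) // ¬ HasPattern α π}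

/-- The number of permutations of `Fin n` that avoid `α` and have at least `k` fixed points. -/
noncomputable def avoidGeCount {m : ℕ} (α : Perm (Fin m)) (n k : ℕ) : ℕ :=
  Nat.card {π : Perm (Fin n) // ¬ HasPattern α π ∧ k ≤ fixCount π}

theorem numFixed_eq_fixCount {n : ℕ} (π : Perm (Fin n)) : numFixed π = fixCount π := by
  classical
  rw [numFixed, fixCount, Nat.card_eq_fintype_card, Fintype.card_subtype]

theorem s_singleton {m : ℕ} (α : Perm (Fin m)) (n k : ℕ) :
    s n k {α} = Nat.card {π : Perm (Fin n) // ¬ HasPattern α π ∧ fixCount π = k} := by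
  rw [s, ← Nat.card_coe_set_eq]
  refine Nat.card_congr (Equiv.subtypeEquivRight fun π => ?_)
  simp only [avoidSet, Set.mem_singleton_iff, forall_eq, Set.mem_ofPred_eq, numFixed_eq_fixCount]
  rfl

theorem hasPattern_three (α : Perm (Fin 3)) (π : Perm X) :
    HasPattern α π ↔ ∃ x y z, x < y ∧ y < z ∧
      ∀ a b, π (![x, y, z] a) < π (![x, y, z] b) ↔ α a < α b := by
  constructor
  · rintro ⟨i, hi, h⟩
    refine ⟨i 0, i 1, i 2, hi (by decide), hi (by decide), ?_⟩
    have : ![i 0, i 1, i 2] = i := by ext a; fin_cases a <;> rfl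
    rwa [this]
  · rintro ⟨x, y, z, hxy, hyz, h⟩
    refine ⟨![x, y, z], ?_, h⟩
    rw [Fin.strictMono_iff_lt_succ]
    intro a
    fin_cases a
    · exact hxy
    · exact hyz

theorem hasPattern_p123 (π : Perm X) : HasPattern p123 π ↔
    ∃ x y z, x < y ∧ y < z ∧ π x < π y ∧ π y < π z := by
  simp only [hasPattern_three, Fin.forall_fin_succ, p123, Equiv.coe_fn_mk]
  simp
  grind

theorem hasPattern_p132 (π : Perm X) : HasPattern p132 π ↔
    ∃ x y z, x < y ∧ y < z ∧ π x < π z ∧ π z < π y := by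
  simp only [hasPattern_three, Fin.forall_fin_succ, p132, Equiv.coe_fn_mk]
  simp
  grind

theorem hasPattern_p213 (π : Perm X) : HasPattern p213 π ↔
    ∃ x y z, x < y ∧ y < z ∧ π y < π x ∧ π x < π z := by
  simp only [hasPattern_three, Fin.forall_fin_succ, p213, Equiv.coe_fn_mk]
  simp
  grind

theorem hasPattern_p231 (π : Perm X) : HasPattern p231 π ↔
    ∃ x y z, x < y ∧ y < z ∧ π z < π x ∧ π x < π y := by
  simp only [hasPattern_three, Fin.forall_fin_succ, p231, Equiv.coe_fn_mk]
  simp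
  grind

theorem hasPattern_p312 (π : Perm X) : HasPattern p312 π ↔
    ∃ x y z, x < y ∧ y < z ∧ π y < π z ∧ π z < π x := by
  simp only [hasPattern_three, Fin.forall_fin_succ, p312, Equiv.coe_fn_mk]
  simp
  grind

theorem hasPattern_p321 (π : Perm X) : HasPattern p321 π ↔
    ∃ x y z, x < y ∧ y < z ∧ π z < π y ∧ π y < π x := by
  simp only [hasPattern_three, Fin.forall_fin_succ, p321, Equiv.coe_fn_mk]
  simp
  grind

theorem HasPattern.of_subtype {m : ℕ} {α : Perm (Fin m)} {p : X → Prop} {σ : Perm {x // p x}}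
    {π : Perm X} (hσ : ∀ x : {x // p x}, (σ x : X) = π x) (h : HasPattern α σ) :
    HasPattern α π := by
  obtain ⟨i, hi, h⟩ := h
  refine ⟨fun a => i a, fun a b hab => hi hab, fun a b => ?_⟩
  rw [← h a b, ← hσ, ← hσ]
  rfl

theorem hasPattern_permCongr {m : ℕ} (α : Perm (Fin m)) (e : X ≃o Y) (π : Perm X) :
    HasPattern α (e.toEquiv.permCongr π) ↔ HasPattern α π := by
  constructor
  · rintro ⟨i, hi, h⟩
    refine ⟨fun a => e.symm (i a), e.symm.strictMono.comp hi, fun a b => ?_⟩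
    rw [← h a b]
    simp
  · rintro ⟨i, hi, h⟩
    refine ⟨fun a => e (i a), e.strictMono.comp hi, fun a b => ?_⟩
    rw [← h a b]
    simp

theorem fixCount_permCongr {X Y : Type*} (e : X ≃ Y) (π : Perm X) :
    fixCount (e.permCongr π) = fixCount π := by
  refine (Nat.card_congr (e.subtypeEquiv fun x => ?_)).symm
  simp

theorem card_avoid_eq {m n : ℕ} (α : Perm (Fin m)) (e : X ≃o Fin n) :
    Nat.card {π : Perm X // ¬ HasPattern α π} = avoidCount α n :=
  Nat.card_congr (e.toEquiv.permCongr.subtypeEquiv fun π => by rw [hasPattern_permCongr])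

theorem card_avoid_fix_eq {m n : ℕ} (α : Perm (Fin m)) (k : ℕ) (e : X ≃o Fin n) :
    Nat.card {π : Perm X // ¬ HasPattern α π ∧ fixCount π = k} = s n k {α} := by
  rw [s_singleton]
  exact Nat.card_congr (e.toEquiv.permCongr.subtypeEquiv fun π => by
    rw [hasPattern_permCongr, fixCount_permCongr])

end General

/-! ### Gluing permutations of disjoint subsets -/

section Join

variable {X : Type*} {p q : X → Prop} [DecidablePred p] [DecidablePred q]

/-- The permutation acting as `σ` on `p`, as `τ` on `q`, and trivially elsewhere
(for disjoint `p` and `q`). -/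
def joinPerm (σ : Perm {x // p x}) (τ : Perm {x // q x}) : Perm X :=
  Perm.ofSubtype σ * Perm.ofSubtype τ

theorem joinPerm_left (hpq : ∀ x, p x → ¬ q x) (σ : Perm {x // p x}) (τ : Perm {x // q x})
    {x : X} (hx : p x) : joinPerm σ τ x = σ ⟨x, hx⟩ := by
  rw [joinPerm, Perm.mul_apply, Perm.ofSubtype_apply_of_not_mem τ (hpq x hx),
    Perm.ofSubtype_apply_of_mem σ hx]

theorem joinPerm_right (hpq : ∀ x, p x → ¬ q x) (σ : Perm {x // p x}) (τ : Perm {x // q x})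
    {x : X} (hx : q x) : joinPerm σ τ x = τ ⟨x, hx⟩ := by
  rw [joinPerm, Perm.mul_apply, Perm.ofSubtype_apply_of_mem τ hx,
    Perm.ofSubtype_apply_of_not_mem σ fun h => hpq _ h (τ ⟨x, hx⟩).2]

theorem joinPerm_of_not (σ : Perm {x // p x}) (τ : Perm {x // q x})
    {x : X} (hp : ¬ p x) (hq : ¬ q x) : joinPerm σ τ x = x := by
  rw [joinPerm, Perm.mul_apply, Perm.ofSubtype_apply_of_not_mem τ hq,
    Perm.ofSubtype_apply_of_not_mem σ hp]

/-- Turns a structural decomposition into a product of counts: when `Φ` forces both parts to be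
invariant and all other points fixed, restriction to the two parts inverts `joinPerm`. -/
theorem card_eq_mul_of_joinPerm [Finite X] (hpq : ∀ x, p x → ¬ q x) (Φ : Perm X → Prop)
    (A : Perm {x // p x} → Prop) (B : Perm {x // q x} → Prop)
    (hp : ∀ π, Φ π → ∀ x, p x → p (π x)) (hq : ∀ π, Φ π → ∀ x, q x → q (π x))
    (hfix : ∀ π, Φ π → ∀ x, ¬ p x → ¬ q x → π x = x)
    (hjoin : ∀ σ τ, Φ (joinPerm σ τ) ↔ A σ ∧ B τ) :
    Nat.card {π // Φ π} = Nat.card {σ // A σ} * Nat.card {τ // B τ} := by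
  rw [← Nat.card_prod]
  symm
  refine Nat.card_congr (Equiv.ofBijective
    (fun στ : {σ // A σ} × {τ // B τ} =>
      (⟨joinPerm στ.1.1 στ.2.1, (hjoin _ _).2 ⟨στ.1.2, στ.2.2⟩⟩ : {π // Φ π})) ⟨?_, ?_⟩)
  · rintro ⟨⟨σ, hσ⟩, ⟨τ, hτ⟩⟩ ⟨⟨σ', hσ'⟩, ⟨τ', hτ'⟩⟩ h
    have h' : joinPerm σ τ = joinPerm σ' τ' := congrArg Subtype.val h
    have h1 : σ = σ' := by
      ext ⟨x, hx⟩
      rw [← joinPerm_left hpq σ τ hx, ← joinPerm_left hpq σ' τ' hx, h']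
    have h2 : τ = τ' := by
      ext ⟨x, hx⟩
      rw [← joinPerm_right hpq σ τ hx, ← joinPerm_right hpq σ' τ' hx, h']
    subst h1 h2
    rfl
  · rintro ⟨π, hπ⟩
    have hp' : ∀ x, p (π x) ↔ p x := fun x =>
      ⟨fun h => by
        by_contra hx
        by_cases hx' : q x
        · exact hpq _ h (hq π hπ x hx')
        · exact hx (hfix π hπ x hx hx' ▸ h), hp π hπ x⟩
    have hq' : ∀ x, q (π x) ↔ q x := fun x =>
      ⟨fun h => by
        by_contra hx
        by_cases hx' : p x
        · exact hpq _ (hp π hπ x hx') h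
        · exact hx (hfix π hπ x hx' hx ▸ h), hq π hπ x⟩
    have key : joinPerm (π.subtypePerm hp') (π.subtypePerm hq') = π := by
      ext x
      by_cases hx : p x
      · rw [joinPerm_left hpq _ _ hx]; rfl
      · by_cases hx' : q x
        · rw [joinPerm_right hpq _ _ hx']; rfl
        · rw [joinPerm_of_not _ _ hx hx', hfix π hπ x hx hx']
    have hAB := (hjoin (π.subtypePerm hp') (π.subtypePerm hq')).1 (key.symm ▸ hπ)
    exact ⟨⟨⟨_, hAB.1⟩, ⟨_, hAB.2⟩⟩, Subtype.ext key⟩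

end Join

/-! ### Marking a fixed point, and the renewal recurrence -/

section Marked

/-- The number of fixed points of `π` below `i`. -/
noncomputable def fixBelow {n : ℕ} (π : Perm (Fin n)) (i : Fin n) : ℕ :=
  Nat.card {x // x < i ∧ π x = x}

/-- `fixBelow` is strictly increasing along the fixed points, so it numbers them 0, 1, ...,
`fixCount π - 1` bijectively. -/
theorem existsUnique_fixBelow_eq {n : ℕ} {π : Perm (Fin n)} {k : ℕ} (hk : k < fixCount π) :
    ∃! i, π i = i ∧ fixBelow π i = k := by
  classical
  have hb : ∀ i, fixBelow π i = ((Finset.univ.filter fun x => π x = x).filter (· < i)).card := by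
    intro i
    rw [fixBelow, Nat.card_eq_fintype_card, Fintype.card_subtype, Finset.filter_filter]
    simp only [and_comm]
  have hf : fixCount π = (Finset.univ.filter fun x => π x = x).card := by
    rw [fixCount, Nat.card_eq_fintype_card, Fintype.card_subtype]
  set S := Finset.univ.filter fun x => π x = x with hS
  have hmem : ∀ x, x ∈ S ↔ π x = x := by simp [hS]
  have hlt : ∀ i ∈ S, ∀ j, i < j → fixBelow π i < fixBelow π j := by
    intro i hi j hij
    rw [hb, hb]
    refine Finset.card_lt_card ⟨?_, fun h => ?_⟩
    · intro x hx
      simp only [Finset.mem_filter] at hx ⊢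
      exact ⟨hx.1, hx.2.trans hij⟩
    · have := h (Finset.mem_filter.2 ⟨hi, hij⟩)
      simp at this
  have hinj : Set.InjOn (fixBelow π) S := by
    intro i hi j hj h
    rcases lt_trichotomy i j with hij | hij | hij
    · exact absurd h (hlt i hi j hij).ne
    · exact hij
    · exact absurd h (hlt j hj i hij).ne'
  have himg : S.image (fixBelow π) = Finset.range S.card := by
    refine Finset.eq_of_subset_of_card_le ?_ ?_
    · intro c hc
      obtain ⟨i, hi, rfl⟩ := Finset.mem_image.1 hc
      rw [Finset.mem_range, hb]
      refine Finset.card_lt_card ⟨Finset.filter_subset _ _, fun h => ?_⟩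
      have := h hi
      simp at this
    · rw [Finset.card_image_of_injOn hinj, Finset.card_range]
  have : k ∈ S.image (fixBelow π) := by rw [himg, Finset.mem_range, ← hf]; exact hk
  obtain ⟨i, hi, rfl⟩ := Finset.mem_image.1 this
  exact ⟨i, ⟨(hmem i).1 hi, rfl⟩, fun j hj => hinj ((hmem j).2 hj.1) hi hj.2⟩

theorem fixBelow_lt_fixCount {n : ℕ} {π : Perm (Fin n)} {i : Fin n} (hi : π i = i) :
    fixBelow π i < fixCount π := by
  classical
  rw [fixBelow, fixCount, Nat.card_eq_fintype_card, Nat.card_eq_fintype_card,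
    Fintype.card_subtype, Fintype.card_subtype]
  refine Finset.card_lt_card ⟨fun x hx => ?_, fun h => ?_⟩
  · simp only [Finset.mem_filter] at hx ⊢
    exact ⟨hx.1, hx.2.2⟩
  · have := h (Finset.mem_filter.2 ⟨Finset.mem_univ i, hi⟩)
    simp at this

theorem avoidGeCount_succ {m : ℕ} (α : Perm (Fin m)) (n k : ℕ) :
    avoidGeCount α n (k + 1) = ∑ i : Fin n,
      Nat.card {π : Perm (Fin n) // ¬ HasPattern α π ∧ π i = i ∧ fixBelow π i = k} := by
  rw [← Nat.card_sigma, avoidGeCount]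
  symm
  refine Nat.card_congr (Equiv.ofBijective
    (fun x => ⟨x.2.1, x.2.2.1, by
      have := fixBelow_lt_fixCount x.2.2.2.1
      rwa [x.2.2.2.2] at this⟩) ⟨?_, ?_⟩)
  · rintro ⟨i, π, hπ, hi, hk⟩ ⟨j, ρ, hρ, hj, hk'⟩ h
    have h' : π = ρ := congrArg Subtype.val h
    subst h'
    have : k < fixCount π := hk ▸ fixBelow_lt_fixCount hi
    obtain rfl := (existsUnique_fixBelow_eq this).unique ⟨hi, hk⟩ ⟨hj, hk'⟩
    rfl
  · rintro ⟨π, hπ, hk⟩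
    obtain ⟨i, hi, -⟩ := existsUnique_fixBelow_eq (k := k) (π := π) hk
    exact ⟨⟨i, π, hπ, hi⟩, rfl⟩

theorem avoidGeCount_zero {m : ℕ} (α : Perm (Fin m)) (n : ℕ) :
    avoidGeCount α n 0 = avoidCount α n :=
  Nat.card_congr (Equiv.subtypeEquivRight fun π => by simp)

theorem avoidGeCount_eq_add {m : ℕ} (α : Perm (Fin m)) (n k : ℕ) :
    avoidGeCount α n k = s n k {α} + avoidGeCount α n (k + 1) := by
  classical
  rw [s_singleton, avoidGeCount, avoidGeCount, Nat.card_eq_fintype_card, Nat.card_eq_fintype_card,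
    Nat.card_eq_fintype_card, ← Fintype.card_subtype_or_disjoint]
  · refine Fintype.card_congr (Equiv.subtypeEquivRight fun π => ?_)
    rw [← and_or_left, le_iff_eq_or_lt, eq_comm, Nat.succ_le_iff]
  · rw [Pi.disjoint_iff]
    intro π
    rw [Prop.disjoint_iff]
    rintro ⟨⟨-, h⟩, -, h'⟩
    omega

/-- Two patterns satisfying the same renewal recurrence have the same fixed point distribution. -/
theorem s_eq_of_recurrence {m : ℕ} {α β : Perm (Fin m)}
    (hc : ∀ n, avoidCount α n = avoidCount β n)
    (hα : ∀ n k, avoidGeCount α (n + 1) (k + 1) =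
      ∑ j ∈ Finset.range (n + 1), s j k {α} * avoidCount α (n - j))
    (hβ : ∀ n k, avoidGeCount β (n + 1) (k + 1) =
      ∑ j ∈ Finset.range (n + 1), s j k {β} * avoidCount β (n - j)) (n k : ℕ) :
    s n k {α} = s n k {β} := by
  have key : ∀ k n, avoidGeCount α n k = avoidGeCount β n k := by
    intro k
    induction k with
    | zero => intro n; rw [avoidGeCount_zero, avoidGeCount_zero, hc]
    | succ k ih =>
      intro n
      -- At length n+1 the recurrence uses only lengths j ≤ n. There `s j k` is the difference of
      -- the "at least k" count (outer induction) and the "at least k+1" count (inner induction).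
      induction n using Nat.strong_induction_on with
      | _ n ihn =>
        cases n with
        | zero => rw [avoidGeCount_succ, avoidGeCount_succ]; simp
        | succ n =>
          rw [hα, hβ]
          refine Finset.sum_congr rfl fun j hj => ?_
          have h1 := avoidGeCount_eq_add α j k
          have h2 := avoidGeCount_eq_add β j k
          have h3 := ih j
          have h4 := ihn j (Finset.mem_range.1 hj)
          rw [hc, show s j k {α} = s j k {β} by omega]
  have h1 := avoidGeCount_eq_add α n k
  have h2 := avoidGeCount_eq_add β n k
  have h3 := key k n
  have h4 := key (k + 1) n
  omega

end Marked

/-! ### Renewal for 321: a fixed point splits the permutation -/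

section Renewal321

theorem mem_of_mapsTo {X : Type*} [Finite X] {π : Perm X} {S : Set X} (h : Set.MapsTo π S S)
    {x : X} (hx : π x ∈ S) : x ∈ S := by
  obtain ⟨y, hy⟩ := Finite.surjective_of_injective
    ((h.restrict_inj).2 π.injective.injOn) ⟨π x, hx⟩
  have : π y = π x := congrArg Subtype.val hy
  exact π.injective this ▸ y.2

/-- If some x < i went above i, then no y > i could go below i, since x, i, y would form a 321. So
the points above i would be mapped into, hence onto, themselves, leaving no room for `π x`. -/
theorem lt_of_lt_of_fixed_p321 {n : ℕ} {π : Perm (Fin n)} (h : ¬ HasPattern p321 π) {i x : Fin n}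
    (hi : π i = i) (hx : x < i) : π x < i := by
  rw [hasPattern_p321] at h
  by_contra hlt
  have hxi : i < π x :=
    lt_of_le_of_ne (not_lt.1 hlt) fun h' => hx.ne (π.injective (h'.symm.trans hi.symm))
  have hmaps : Set.MapsTo π (Set.Ioi i) (Set.Ioi i) := by
    intro y hy
    by_contra hy'
    have hyi : π y < i := lt_of_le_of_ne (not_lt.1 hy') fun h' =>
      (ne_of_gt hy) (π.injective (h'.trans hi.symm))
    exact h ⟨x, i, y, hx, hy, hi.symm ▸ hyi, hi.symm ▸ hxi⟩
  exact lt_asymm hx (mem_of_mapsTo hmaps hxi)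

theorem lt_of_gt_of_fixed_p321 {n : ℕ} {π : Perm (Fin n)} (h : ¬ HasPattern p321 π) {i x : Fin n}
    (hi : π i = i) (hx : i < x) : i < π x := by
  have hmaps : Set.MapsTo π (Set.Iio i) (Set.Iio i) := fun y hy =>
    lt_of_lt_of_fixed_p321 h hi hy
  by_contra hlt
  have hxi : π x < i :=
    lt_of_le_of_ne (not_lt.1 hlt) fun h' => hx.ne' (π.injective (h'.trans hi.symm))
  exact lt_asymm hx (mem_of_mapsTo hmaps hxi)

/-- Fixed points below `i` are the fixed points of the restriction to a set `p` below `i`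
containing all of them. -/
theorem fixBelow_eq_fixCount {n : ℕ} {π : Perm (Fin n)} {i : Fin n} {p : Fin n → Prop}
    {σ : Perm {x // p x}} (hσ : ∀ x : {x // p x}, (σ x : Fin n) = π x)
    (hp : ∀ x, p x → x < i) (hp' : ∀ x < i, π x = x → p x) :
    fixBelow π i = fixCount σ := by
  refine Nat.card_congr
    { toFun := fun x => ⟨⟨x, hp' x x.2.1 x.2.2⟩, Subtype.ext (by rw [hσ]; exact x.2.2)⟩
      invFun := fun x => ⟨x.1, hp _ x.1.2, by rw [← hσ, x.2]⟩
      left_inv := fun x => rfl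
      right_inv := fun x => rfl }

theorem card_marked_p321 {n : ℕ} (k : ℕ) (i : Fin (n + 1)) :
    Nat.card {π : Perm (Fin (n + 1)) // ¬ HasPattern p321 π ∧ π i = i ∧ fixBelow π i = k} =
      s i k {p321} * avoidCount p321 (n - i) := by
  have hpq : ∀ x : Fin (n + 1), x < i → ¬ i < x := fun x hx => lt_asymm hx
  rw [card_eq_mul_of_joinPerm (p := fun x => x < i) (q := fun x => i < x) hpq
    (A := fun σ => ¬ HasPattern p321 σ ∧ fixCount σ = k) (B := fun τ => ¬ HasPattern p321 τ)
    (hp := fun π hπ x hx => lt_of_lt_of_fixed_p321 hπ.1 hπ.2.1 hx)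
    (hq := fun π hπ x hx => lt_of_gt_of_fixed_p321 hπ.1 hπ.2.1 hx)]
  · congr 1
    · refine card_avoid_fix_eq _ _ (Fintype.orderIsoFinOfCardEq _ ?_).symm
      rw [Fintype.card_subtype]
      convert Fin.card_Iio i using 2
      ext x
      simp
    · refine card_avoid_eq _ (Fintype.orderIsoFinOfCardEq _ ?_).symm
      rw [Fintype.card_subtype]
      convert Fin.card_Ioi i using 2
      · ext x
        simp
      · simp
  · intro π hπ x hx hx'
    obtain rfl : x = i := le_antisymm (not_lt.1 hx') (not_lt.1 hx)
    exact hπ.2.1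
  · intro σ τ
    have hl : ∀ x : {x // x < i}, (σ x : Fin (n + 1)) = joinPerm σ τ x := fun x =>
      (joinPerm_left hpq σ τ x.2).symm
    have hr : ∀ x : {x // i < x}, (τ x : Fin (n + 1)) = joinPerm σ τ x := fun x =>
      (joinPerm_right hpq σ τ x.2).symm
    have hi : joinPerm σ τ i = i := joinPerm_of_not σ τ (lt_irrefl i) (lt_irrefl i)
    have hfix : fixBelow (joinPerm σ τ) i = fixCount σ :=
      fixBelow_eq_fixCount hl (fun _ h => h) (fun _ h _ => h)
    rw [hfix]
    constructor
    · rintro ⟨h1, -, h3⟩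
      exact ⟨⟨fun h => h1 (h.of_subtype hl), h3⟩, fun h => h1 (h.of_subtype hr)⟩
    · rintro ⟨⟨h1, h3⟩, h2⟩
      refine ⟨fun h => ?_, hi, h3⟩
      rw [hasPattern_p321] at h h1 h2
      obtain ⟨x, y, z, hxy, hyz, hzy, hyx⟩ := h
      have hvl : ∀ x, x < i → joinPerm σ τ x < i := fun x hx => hl ⟨x, hx⟩ ▸ (σ ⟨x, hx⟩).2
      have hvr : ∀ x, i < x → i < joinPerm σ τ x := fun x hx => hr ⟨x, hx⟩ ▸ (τ ⟨x, hx⟩).2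
      rcases lt_trichotomy x i with hx | hx | hx
      · have hz : z < i := by
          by_contra hz
          have hzi : i ≤ joinPerm σ τ z := by
            rcases (not_lt.1 hz).eq_or_lt with h | h
            · rw [← h, hi]
            · exact (hvr z h).le
          exact absurd ((hzy.trans hyx).trans (hvl x hx)) (not_lt.2 hzi)
        refine h1 ⟨⟨x, hx⟩, ⟨y, hyz.trans hz⟩, ⟨z, hz⟩, hxy, hyz, ?_, ?_⟩
        · rw [← Subtype.coe_lt_coe, hl, hl]; exact hzy
        · rw [← Subtype.coe_lt_coe, hl, hl]; exact hyx
      · subst hx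
        rw [hi] at hyx
        exact lt_asymm hyx (hvr y hxy)
      · refine h2 ⟨⟨x, hx⟩, ⟨y, hx.trans hxy⟩, ⟨z, (hx.trans hxy).trans hyz⟩, hxy, hyz, ?_, ?_⟩
        · rw [← Subtype.coe_lt_coe, hr, hr]; exact hzy
        · rw [← Subtype.coe_lt_coe, hr, hr]; exact hyx

theorem avoidGeCount_p321_succ (n k : ℕ) : avoidGeCount p321 (n + 1) (k + 1) =
    ∑ j ∈ Finset.range (n + 1), s j k {p321} * avoidCount p321 (n - j) := by
  rw [avoidGeCount_succ, Finset.sum_range]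
  exact Finset.sum_congr rfl fun i _ => card_marked_p321 k i

end Renewal321

/-! ### Renewal for 132: a fixed point closes a diagonal block -/

section Renewal132

/-- The first `r` entries of `ρ` are at least `r`, and the entries that are at least `r` among the
remaining ones are increasing. -/
def IsCorner {m : ℕ} (r : ℕ) (ρ : Perm (Fin m)) : Prop :=
  (∀ x : Fin m, x.val < r → r ≤ (ρ x).val) ∧
    ∀ x y : Fin m, x < y → r ≤ x.val → r ≤ (ρ x).val → r ≤ (ρ y).val → ρ x < ρ y

theorem existsUnique_isCorner {m : ℕ} {ρ : Perm (Fin m)} (h : ¬ HasPattern p132 ρ) :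
    ∃! r, r < m + 1 ∧ IsCorner r ρ := by
  classical
  rw [hasPattern_p132] at h
  have hle : ∀ r t, r < t → t < m + 1 → IsCorner r ρ → IsCorner t ρ → False := by
    -- For corners r < t, the entry at position r is at least t, while the value r sits at some
    -- position y ≥ t. Both entries lie in the region where corner r demands increase, yet they
    -- decrease.
    intro r t hrt htm hr ht
    have hp : r < m := by omega
    have h1 := ht.1 ⟨r, hp⟩ hrt
    obtain ⟨y, hy⟩ := ρ.surjective ⟨r, hp⟩
    have hyt : t ≤ y.val := by
      by_contra hlt
      have := ht.1 y (by omega)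
      rw [hy] at this
      simp at this
      omega
    have := hr.2 ⟨r, hp⟩ y (by rw [Fin.lt_def]; simp; omega) le_rfl (by omega) (by rw [hy])
    rw [hy, Fin.lt_def] at this
    simp at this
    omega
  -- The corner is the least r for which the square [0,r]×[0,r] contains an entry, or m if there is
  -- none. That entry serves as the "1" of a 132 for any descent in the region that has to be
  -- increasing.
  have hex : ∃ r, r < m + 1 ∧ (∀ x : Fin m, x.val < r → r ≤ (ρ x).val) ∧
      (r < m → ∃ x : Fin m, x.val ≤ r ∧ (ρ x).val ≤ r) := by
    have hne : ∃ r, m ≤ r ∨ ∃ x : Fin m, x.val ≤ r ∧ (ρ x).val ≤ r := ⟨m, Or.inl le_rfl⟩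
    refine ⟨Nat.find hne, ?_, ?_, ?_⟩
    · exact Nat.lt_succ_of_le (Nat.find_min' hne (Or.inl le_rfl))
    · intro x hx
      by_contra hlt
      have : Nat.find hne ≠ 0 := by omega
      refine Nat.find_min hne (m := Nat.find hne - 1) (by omega) (Or.inr ⟨x, by omega, by omega⟩)
    · intro hlt
      rcases Nat.find_spec hne with h | h
      · omega
      · exact h
  obtain ⟨r, hr, hr1, hr2⟩ := hex
  have hrc : IsCorner r ρ := by
    refine ⟨hr1, ?_⟩
    intro x y hxy hx hrx hry
    obtain ⟨w, hw, hw'⟩ := hr2 (by omega)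
    by_contra hlt
    have hyx : ρ y < ρ x := lt_of_le_of_ne (not_lt.1 hlt) fun h' => hxy.ne' (ρ.injective h')
    have hwx : w ≠ x := by
      rintro rfl
      rw [Fin.lt_def] at hyx
      omega
    have hwy : w ≠ y := by
      rintro rfl
      rw [Fin.lt_def] at hxy
      omega
    have hwy' : ρ w ≠ ρ y := fun h' => hwy (ρ.injective h')
    refine h ⟨w, x, y, ?_, hxy, ?_, hyx⟩
    · rw [Fin.lt_def]; rw [Ne, Fin.ext_iff] at hwx; omega
    · rw [Fin.lt_def]; rw [Ne, Fin.ext_iff] at hwy'; omega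
  refine ⟨r, ⟨hr, hrc⟩, ?_⟩
  rintro t ⟨ht, htc⟩
  rcases lt_trichotomy t r with h' | h' | h'
  · exact (hle _ _ h' hr htc hrc).elim
  · exact h'
  · exact (hle _ _ h' ht hrc htc).elim

/-- The number of `132`-avoiding permutations with corner `r`. -/
noncomputable def cornerCount (m r : ℕ) : ℕ :=
  Nat.card {ρ : Perm (Fin m) // ¬ HasPattern p132 ρ ∧ IsCorner r ρ}

theorem card_eq_sum_of_existsUnique {Z : Type*} [Finite Z] (P : Z → Prop) (Q : ℕ → Z → Prop)
    (N : ℕ) (h : ∀ z, P z → ∃! r, r < N ∧ Q r z) :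
    Nat.card {z // P z} = ∑ r ∈ Finset.range N, Nat.card {z // P z ∧ Q r z} := by
  rw [Finset.sum_range, ← Nat.card_sigma]
  symm
  refine Nat.card_congr (Equiv.ofBijective (fun x => ⟨x.2.1, x.2.2.1⟩) ⟨?_, ?_⟩)
  · rintro ⟨r, z, hz, hr⟩ ⟨t, w, hw, ht⟩ hzw
    have hzw' : z = w := congrArg Subtype.val hzw
    subst hzw'
    obtain rfl : r = t := Fin.ext ((h z hz).unique ⟨r.2, hr⟩ ⟨t.2, ht⟩)
    rfl
  · rintro ⟨z, hz⟩
    obtain ⟨r, ⟨hr, hrz⟩, -⟩ := h z hz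
    exact ⟨⟨⟨r, hr⟩, z, hz, hrz⟩, rfl⟩

theorem avoidCount_p132_eq_sum (m : ℕ) :
    avoidCount p132 m = ∑ r ∈ Finset.range (m + 1), cornerCount m r :=
  card_eq_sum_of_existsUnique _ IsCorner _ fun _ hρ => existsUnique_isCorner hρ

/-- `r` is the left end of the block of positions below `i` with values below `i`. -/
def IsBlockStart {n : ℕ} (i : Fin n) (r : ℕ) (π : Perm (Fin n)) : Prop :=
  (∀ x : Fin n, x.val < r → i < π x) ∧ ∀ x : Fin n, r ≤ x.val → x < i → π x < i

/-- The block starts at the first position whose value is at most i. A later position before i with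
value above i would form a 132 with that first position and i itself. -/
theorem existsUnique_isBlockStart {n : ℕ} {π : Perm (Fin n)} (h : ¬ HasPattern p132 π) {i : Fin n}
    (hi : π i = i) : ∃! r, r < i.val + 1 ∧ IsBlockStart i r π := by
  classical
  rw [hasPattern_p132] at h
  have hle : ∀ r t, r < t → t < i.val + 1 → IsBlockStart i r π → IsBlockStart i t π → False := by
    intro r t hrt hti hr ht
    exact lt_asymm (hr.2 ⟨r, by omega⟩ le_rfl (Fin.lt_def.2 (by simp; omega)))
      (ht.1 ⟨r, by omega⟩ hrt)
  have hex : ∃ r, ∃ x : Fin n, x.val = r ∧ π x ≤ i := ⟨i, i, rfl, hi.le⟩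
  have hfind : Nat.find hex ≤ i.val := Nat.find_min' hex ⟨i, rfl, hi.le⟩
  have hblock : IsBlockStart i (Nat.find hex) π := by
    refine ⟨fun x hx => ?_, fun x hx hxi => ?_⟩
    · by_contra hlt
      exact Nat.find_min hex hx ⟨x, rfl, not_lt.1 hlt⟩
    · have hne : ∀ y, y < i → π y ≠ i := fun y hy h' => hy.ne (π.injective (h'.trans hi.symm))
      obtain ⟨y, hy, hyi⟩ := Nat.find_spec hex
      have hyx : y ≤ x := by rw [Fin.le_def]; omega
      have hyi' : π y < i := lt_of_le_of_ne hyi (hne y (hyx.trans_lt hxi))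
      by_contra hlt
      have hxi' : i < π x := lt_of_le_of_ne (not_lt.1 hlt) (hne x hxi).symm
      have hyx' : y < x := lt_of_le_of_ne hyx fun h' => by
        subst h'
        exact lt_asymm hxi' hyi'
      exact h ⟨y, x, i, hyx', hxi, hi.symm ▸ hyi', hi.symm ▸ hxi'⟩
  refine ⟨Nat.find hex, ⟨Nat.lt_succ_of_le hfind, hblock⟩, ?_⟩
  rintro t ⟨ht, htb⟩
  rcases lt_trichotomy t (Nat.find hex) with h' | h' | h'
  · exact (hle _ _ h' (by omega) htb hblock).elim
  · exact h'
  · exact (hle _ _ h' ht hblock htb).elim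

/-- Values in [π x, i) must come from positions in [r,i): positions before r carry values above i,
and a position y after i would make x, i, y a 132. Comparing sizes, i - π x ≤ i - r, so the block is
a square. -/
theorem IsBlockStart.le_apply {n : ℕ} {π : Perm (Fin n)} (h : ¬ HasPattern p132 π) {i : Fin n}
    (hi : π i = i) {r : ℕ} (hr : r ≤ i.val) (hb : IsBlockStart i r π) {x : Fin n}
    (hx : r ≤ x.val) (hxi : x < i) : r ≤ (π x).val := by
  rw [hasPattern_p132] at h
  have hv : π x < i := hb.2 x hx hxi
  have hcard : (Finset.Ico (π x) i).card ≤ (Finset.Ico (⟨r, hr.trans_lt i.2⟩ : Fin n) i).card := by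
    refine Finset.card_le_card_of_injOn π.symm ?_ π.symm.injective.injOn
    intro u hu
    obtain ⟨y, rfl⟩ := π.surjective u
    simp only [Finset.coe_Ico, Set.mem_Ico, symm_apply_apply] at hu ⊢
    refine ⟨?_, ?_⟩
    · by_contra hlt
      exact lt_asymm hu.2 (hb.1 y (by rw [Fin.le_def] at hlt; simpa using hlt))
    · by_contra hlt
      rcases (not_lt.1 hlt).eq_or_lt with h' | h'
      · rw [← h', hi] at hu
        exact lt_irrefl _ hu.2
      · have : π x ≠ π y := fun h'' => (hxi.trans h').ne (π.injective h'')
        exact h ⟨x, i, y, hxi, h', lt_of_le_of_ne hu.1 this, hi.symm ▸ hu.2⟩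
  rw [Fin.card_Ico, Fin.card_Ico] at hcard
  rw [Fin.lt_def] at hv
  simp only at hcard
  omega

theorem exists_outside_orderIso {n : ℕ} (i : Fin (n + 1)) {r : ℕ} (hr : r ≤ i.val) :
    ∃ e : {x : Fin (n + 1) // x.val < r ∨ i < x} ≃o Fin (n - (i - r)),
      ∀ x, (e x).val < r ↔ x.1.val < r := by
  have hin := i.2
  let f : Fin (n - (i - r)) → {x : Fin (n + 1) // x.val < r ∨ i < x} := fun j =>
    if h : j.val < r then ⟨⟨j, by omega⟩, Or.inl h⟩
    else ⟨⟨j + (i - r) + 1, by omega⟩, Or.inr (Fin.lt_def.2 (by simp; omega))⟩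
  have hf : ∀ j, ((f j).1.val = if j.val < r then j.val else j + (i - r) + 1) := by
    intro j
    simp only [f]
    split_ifs <;> rfl
  have hmono : StrictMono f := by
    intro a b hab
    rw [← Subtype.coe_lt_coe, Fin.lt_def, hf, hf]
    rw [Fin.lt_def] at hab
    split_ifs <;> omega
  have hsurj : Function.Surjective f := by
    rintro ⟨x, hx⟩
    rw [Fin.lt_def] at hx
    have hxn := x.2
    by_cases h : x.val < r
    · refine ⟨⟨x, by omega⟩, Subtype.ext (Fin.ext ?_)⟩
      rw [hf]
      simp [h]
    · refine ⟨⟨x - (i - r) - 1, by omega⟩, Subtype.ext (Fin.ext ?_)⟩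
      rw [hf]
      simp only
      split_ifs <;> omega
  refine ⟨(hmono.orderIsoOfSurjective f hsurj).symm, fun x => ?_⟩
  obtain ⟨j, rfl⟩ := hsurj x
  have : (hmono.orderIsoOfSurjective f hsurj).symm (f j) = j :=
    (hmono.orderIsoOfSurjective f hsurj).symm_apply_apply j
  rw [this, hf]
  split_ifs <;> omega

/-- Closing the gap [r,i] identifies what lies outside the block with a standard interval. Among
outside points, being above i becomes being at least r, so the two conditions become exactly
`IsCorner r`. -/
theorem card_outside_p132 {n : ℕ} (i : Fin (n + 1)) {r : ℕ} (hr : r ≤ i.val) :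
    Nat.card {τ : Perm {x : Fin (n + 1) // x.val < r ∨ i < x} // ¬ HasPattern p132 τ ∧
      (∀ x, x.1.val < r → i < (τ x).1) ∧
      ∀ x y, x < y → i < x.1 → i < (τ x).1 → i < (τ y).1 → τ x < τ y} =
      cornerCount (n - (i - r)) r := by
  obtain ⟨e, he⟩ := exists_outside_orderIso i hr
  have he' : ∀ x, r ≤ (e x).val ↔ i < x.1 := by
    intro x
    rw [← not_lt, he]
    have h1 := x.2
    rw [Fin.lt_def] at h1 ⊢
    omega
  refine Nat.card_congr (e.toEquiv.permCongr.subtypeEquiv fun τ => ?_)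
  rw [hasPattern_permCongr, IsCorner]
  simp only [e.toEquiv.surjective.forall, Equiv.permCongr_apply, Equiv.symm_apply_apply]
  simp only [RelIso.coe_fn_toEquiv, he, he', e.lt_iff_lt]

theorem card_block_p132 {n : ℕ} (k : ℕ) (i : Fin (n + 1)) {r : ℕ} (hr : r ≤ i.val) :
    Nat.card {π : Perm (Fin (n + 1)) // (¬ HasPattern p132 π ∧ π i = i ∧ fixBelow π i = k) ∧
      IsBlockStart i r π} = s (i - r) k {p132} * cornerCount (n - (i - r)) r := by
  have hpq : ∀ x : Fin (n + 1), (r ≤ x.val ∧ x < i) → ¬ (x.val < r ∨ i < x) := by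
    rintro x ⟨h1, h2⟩ (h3 | h3)
    · omega
    · exact lt_asymm h2 h3
  have hinv : ∀ π : Perm (Fin (n + 1)), ((¬ HasPattern p132 π ∧ π i = i ∧ fixBelow π i = k) ∧
      IsBlockStart i r π) → ∀ x, (r ≤ x.val ∧ x < i) → r ≤ (π x).val ∧ π x < i :=
    fun π hπ x hx => ⟨hπ.2.le_apply hπ.1.1 hπ.1.2.1 hr hx.1 hx.2, hπ.2.2 x hx.1 hx.2⟩
  rw [card_eq_mul_of_joinPerm (p := fun x => r ≤ x.val ∧ x < i) (q := fun x => x.val < r ∨ i < x)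
    hpq (A := fun σ => ¬ HasPattern p132 σ ∧ fixCount σ = k)
    (B := fun τ => ¬ HasPattern p132 τ ∧ (∀ x, x.1.val < r → i < (τ x).1) ∧
      ∀ x y, x < y → i < x.1 → i < (τ x).1 → i < (τ y).1 → τ x < τ y)
    (hp := hinv), card_outside_p132 i hr]
  · congr 1
    refine card_avoid_fix_eq _ _ (Fintype.orderIsoFinOfCardEq _ ?_).symm
    rw [Fintype.card_subtype]
    convert Fin.card_Ico (⟨r, by omega⟩ : Fin (n + 1)) i using 2
    ext x
    simp [Fin.le_def]
  · intro π hπ x hx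
    rcases hx with hx | hx
    · exact Or.inr (hπ.2.1 x hx)
    · by_contra hq
      push Not at hq
      have hne : π x ≠ i := fun h' => hx.ne' (π.injective (h'.trans hπ.1.2.1.symm))
      -- The block maps into itself, hence onto itself by finiteness, so no point to the right of i
      -- can land in it.
      have := mem_of_mapsTo (S := {x : Fin (n + 1) | r ≤ x.val ∧ x < i}) (fun x hx => hinv π hπ x hx)
        (x := x) ⟨hq.1, lt_of_le_of_ne hq.2 hne⟩
      exact lt_asymm hx this.2
  · intro π hπ x hx hx'
    push Not at hx hx'
    obtain rfl : x = i := le_antisymm hx'.2 (hx hx'.1)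
    exact hπ.1.2.1
  · intro σ τ
    set π := joinPerm σ τ with hπ
    have hl : ∀ x : {x : Fin (n + 1) // r ≤ x.val ∧ x < i}, (σ x : Fin (n + 1)) = π x := fun x =>
      (joinPerm_left hpq σ τ x.2).symm
    have hr' : ∀ x : {x : Fin (n + 1) // x.val < r ∨ i < x}, (τ x : Fin (n + 1)) = π x := fun x =>
      (joinPerm_right hpq σ τ x.2).symm
    have hi : π i = i := joinPerm_of_not σ τ (fun h => lt_irrefl i h.2) (by simpa using hr)
    have hvl : ∀ x : Fin (n + 1), r ≤ x.val → x < i → r ≤ (π x).val ∧ π x < i := fun x hx hx' =>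
      hl ⟨x, hx, hx'⟩ ▸ (σ ⟨x, hx, hx'⟩).2
    have hvr : ∀ x : Fin (n + 1), i < x → (π x).val < r ∨ i < π x := fun x hx =>
      hr' ⟨x, Or.inr hx⟩ ▸ (τ ⟨x, Or.inr hx⟩).2
    have hfix : (∀ x : Fin (n + 1), x.val < r → i < π x) → fixBelow π i = fixCount σ := by
      intro hL
      refine fixBelow_eq_fixCount hl (fun _ h => h.2) (fun x hx hfx => ⟨?_, hx⟩)
      by_contra hlt
      have := hL x (by omega)
      rw [hfx] at this
      exact lt_asymm hx this
    constructor
    · rintro ⟨⟨h1, -, h3⟩, h4, h5⟩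
      rw [hfix h4] at h3
      refine ⟨⟨fun h => h1 (h.of_subtype hl), h3⟩, fun h => h1 (h.of_subtype hr'), ?_, ?_⟩
      · intro x hx
        rw [hr']
        exact h4 x hx
      · intro x y hxy hix hx hy
        rw [hr'] at hx hy
        rw [← Subtype.coe_lt_coe, hr', hr']
        by_contra hlt
        have hne : π y ≠ π x := fun h' => (Subtype.coe_lt_coe.2 hxy).ne' (π.injective h')
        rw [hasPattern_p132] at h1
        -- The fixed point i plays the "1", which is why large entries after i must increase.
        exact h1 ⟨i, x, y, hix, hxy, hi.symm ▸ hy, lt_of_le_of_ne (not_lt.1 hlt) hne⟩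
    · rintro ⟨⟨h1, h3⟩, h2, hL', hR'⟩
      have hL : ∀ x : Fin (n + 1), x.val < r → i < π x := fun x hx => by
        have := hL' ⟨x, Or.inl hx⟩ hx
        rwa [hr'] at this
      have hR : ∀ x y : Fin (n + 1), x < y → i < x → i < π x → i < π y → π x < π y := by
        intro x y hxy hix hx hy
        have := hR' ⟨x, Or.inr hix⟩ ⟨y, Or.inr (hix.trans hxy)⟩ hxy hix
        rw [← Subtype.coe_lt_coe, hr', hr'] at this
        exact this hx hy
      refine ⟨⟨fun h => ?_, hi, by rw [hfix hL, h3]⟩, hL, fun x hx hx' => (hvl x hx hx').2⟩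
      rw [hasPattern_p132] at h h1 h2
      obtain ⟨x, y, z, hxy, hyz, hxz, hzy⟩ := h
      have hσ : ∀ x y z : Fin (n + 1), (r ≤ x.val ∧ x < i) → (r ≤ y.val ∧ y < i) →
          (r ≤ z.val ∧ z < i) → x < y → y < z → π x < π z → π z < π y → False := by
        intro x y z hx hy hz hxy hyz hxz hzy
        refine h1 ⟨⟨x, hx⟩, ⟨y, hy⟩, ⟨z, hz⟩, hxy, hyz, ?_, ?_⟩
        · rw [← Subtype.coe_lt_coe, hl, hl]; exact hxz
        · rw [← Subtype.coe_lt_coe, hl, hl]; exact hzy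
      have hτ : ∀ x y z : Fin (n + 1), (x.val < r ∨ i < x) → (y.val < r ∨ i < y) →
          (z.val < r ∨ i < z) → x < y → y < z → π x < π z → π z < π y → False := by
        intro x y z hx hy hz hxy hyz hxz hzy
        refine h2 ⟨⟨x, hx⟩, ⟨y, hy⟩, ⟨z, hz⟩, hxy, hyz, ?_, ?_⟩
        · rw [← Subtype.coe_lt_coe, hr', hr']; exact hxz
        · rw [← Subtype.coe_lt_coe, hr', hr']; exact hzy
      have hcases : ∀ x : Fin (n + 1), x.val < r ∨ (r ≤ x.val ∧ x < i) ∨ x = i ∨ i < x := by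
        intro x
        rcases lt_trichotomy x i with h | h | h
        · rcases lt_or_ge x.val r with h' | h'
          · exact Or.inl h'
          · exact Or.inr (Or.inl ⟨h', h⟩)
        · exact Or.inr (Or.inr (Or.inl h))
        · exact Or.inr (Or.inr (Or.inr h))
      grind

theorem avoidGeCount_p132_succ (n k : ℕ) : avoidGeCount p132 (n + 1) (k + 1) =
    ∑ j ∈ Finset.range (n + 1), s j k {p132} * avoidCount p132 (n - j) := by
  have h : ∀ i : Fin (n + 1),
      Nat.card {π : Perm (Fin (n + 1)) // ¬ HasPattern p132 π ∧ π i = i ∧ fixBelow π i = k} =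
      ∑ r ∈ Finset.range (i.val + 1), s (i - r) k {p132} * cornerCount (n - (i - r)) r := by
    intro i
    rw [card_eq_sum_of_existsUnique _ (IsBlockStart i) (i.val + 1)
      fun π hπ => existsUnique_isBlockStart hπ.1 hπ.2.1]
    exact Finset.sum_congr rfl fun r hr =>
      card_block_p132 k i (Nat.lt_succ_iff.1 (Finset.mem_range.1 hr))
  rw [avoidGeCount_succ, Finset.sum_congr rfl fun i _ => h i, ← Finset.sum_range
    (f := fun i => ∑ r ∈ Finset.range (i + 1), s (i - r) k {p132} * cornerCount (n - (i - r)) r)]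
  simp only [avoidCount_p132_eq_sum, Finset.mul_sum]
  rw [Finset.sum_sigma', Finset.sum_sigma']
  -- Reindexing (i, r) as (j, r) with j = i - r, the block length, makes the corner counts for fixed
  -- j sum to `avoidCount p132 (n - j)`.
  refine Finset.sum_bij' (fun x _ => ⟨x.1 - x.2, x.2⟩) (fun x _ => ⟨x.1 + x.2, x.2⟩) ?_ ?_ ?_ ?_ ?_
  · rintro ⟨i, r⟩ h
    simp only [Finset.mem_sigma, Finset.mem_range] at h ⊢
    omega
  · rintro ⟨i, r⟩ h
    simp only [Finset.mem_sigma, Finset.mem_range] at h ⊢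
    omega
  · rintro ⟨i, r⟩ h
    simp only [Finset.mem_sigma, Finset.mem_range] at h
    simp only [Nat.sub_add_cancel (Nat.lt_succ_iff.1 h.2)]
  · rintro ⟨i, r⟩ h
    simp
  · rintro ⟨i, r⟩ h
    rfl

end Renewal132

/-! ### Equinumerosity of 213- and 123-avoiders by inserting the maximum -/

section InsertMax

variable {n : ℕ}

/-- Insert a new maximum into `σ` at position `p`. -/
def insertMax (p : Fin (n + 1)) (σ : Perm (Fin n)) : Perm (Fin (n + 1)) :=
  (finSuccEquiv' p).trans ((optionCongr σ).trans (finSuccEquiv' (Fin.last n)).symm)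

@[simp]
theorem insertMax_self (p : Fin (n + 1)) (σ : Perm (Fin n)) : insertMax p σ p = Fin.last n := by
  simp [insertMax]

@[simp]
theorem insertMax_succAbove (p : Fin (n + 1)) (σ : Perm (Fin n)) (i : Fin n) :
    insertMax p σ (p.succAbove i) = (σ i).castSucc := by
  simp [insertMax]

theorem insertMax_bijective :
    Function.Bijective fun x : Fin (n + 1) × Perm (Fin n) => insertMax x.1 x.2 := by
  rw [Fintype.bijective_iff_injective_and_card]
  constructor
  · rintro ⟨p, σ⟩ ⟨q, τ⟩ h
    simp only at h
    obtain rfl : p = q := by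
      apply (insertMax p σ).injective
      rw [insertMax_self, h, insertMax_self]
    congr 1
    ext i
    have := congrArg (fun π => (π (p.succAbove i)).val) h
    simpa using this
  · simp [Fintype.card_perm, Nat.factorial_succ]

theorem card_perm_succ (P : Perm (Fin (n + 1)) → Prop) :
    Nat.card {π // P π} = ∑ p : Fin (n + 1), Nat.card {σ // P (insertMax p σ)} := by
  rw [← Nat.card_sigma]
  symm
  refine Nat.card_congr (Equiv.ofBijective (fun x => ⟨insertMax x.1 x.2.1, x.2.2⟩) ⟨?_, ?_⟩)
  · rintro ⟨p, σ, hσ⟩ ⟨q, τ, hτ⟩ h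
    have := insertMax_bijective.1 (a₁ := (p, σ)) (a₂ := (q, τ)) (congrArg Subtype.val h)
    obtain ⟨rfl, rfl⟩ := Prod.mk.inj this
    rfl
  · rintro ⟨π, hπ⟩
    obtain ⟨⟨p, σ⟩, rfl⟩ := insertMax_bijective.2 π
    exact ⟨⟨p, σ, hπ⟩, rfl⟩

/-- The first `j` entries of `σ` exist and are increasing. -/
def IncPrefix (j : ℕ) (σ : Perm (Fin n)) : Prop :=
  j ≤ n ∧ ∀ a b : Fin n, a < b → b.val < j → σ a < σ b

/-- The first `j` entries of `σ` exist and are decreasing. -/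
def DecPrefix (j : ℕ) (σ : Perm (Fin n)) : Prop :=
  j ≤ n ∧ ∀ a b : Fin n, a < b → b.val < j → σ b < σ a

/-- A new maximum can only play the "3", so it creates a 213 exactly when a descent precedes it. -/
theorem not_hasPattern_p213_insertMax (p : Fin (n + 1)) (σ : Perm (Fin n)) :
    ¬ HasPattern p213 (insertMax p σ) ↔ ¬ HasPattern p213 σ ∧ IncPrefix p.val σ := by
  rw [hasPattern_p213, hasPattern_p213]
  constructor
  · intro h
    refine ⟨?_, Nat.lt_succ_iff.1 p.2, ?_⟩
    · rintro ⟨x, y, z, hxy, hyz, h1, h2⟩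
      exact h ⟨p.succAbove x, p.succAbove y, p.succAbove z, by simpa, by simpa, by simpa, by simpa⟩
    · intro a b hab hb
      by_contra hlt
      have hne : σ b ≠ σ a := fun h' => hab.ne' (σ.injective h')
      have hba := lt_of_le_of_ne (not_lt.1 hlt) hne
      refine h ⟨p.succAbove a, p.succAbove b, p, by simpa, ?_, by simpa, by simp⟩
      rw [Fin.succAbove_lt_iff_castSucc_lt]
      exact hb
  · rintro ⟨h, -, hp⟩ ⟨x, y, z, hxy, hyz, h1, h2⟩
    rcases Fin.eq_self_or_eq_succAbove p x with rfl | ⟨a, rfl⟩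
    · rw [insertMax_self] at h2
      exact not_lt.2 (Fin.le_last _) h2
    rcases Fin.eq_self_or_eq_succAbove p y with rfl | ⟨b, rfl⟩
    · rw [insertMax_self] at h1
      exact not_lt.2 (Fin.le_last _) h1
    simp only [insertMax_succAbove, Fin.castSucc_lt_castSucc_iff] at h1
    rw [Fin.succAbove_lt_succAbove_iff] at hxy
    rcases Fin.eq_self_or_eq_succAbove p z with rfl | ⟨c, rfl⟩
    · rw [Fin.succAbove_lt_iff_castSucc_lt] at hyz
      exact lt_asymm h1 (hp a b hxy hyz)
    · simp only [insertMax_succAbove, Fin.castSucc_lt_castSucc_iff] at h2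
      rw [Fin.succAbove_lt_succAbove_iff] at hyz
      exact h ⟨a, b, c, hxy, hyz, h1, h2⟩

theorem not_hasPattern_p123_insertMax (p : Fin (n + 1)) (σ : Perm (Fin n)) :
    ¬ HasPattern p123 (insertMax p σ) ↔ ¬ HasPattern p123 σ ∧ DecPrefix p.val σ := by
  rw [hasPattern_p123, hasPattern_p123]
  constructor
  · intro h
    refine ⟨?_, Nat.lt_succ_iff.1 p.2, ?_⟩
    · rintro ⟨x, y, z, hxy, hyz, h1, h2⟩
      exact h ⟨p.succAbove x, p.succAbove y, p.succAbove z, by simpa, by simpa, by simpa, by simpa⟩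
    · intro a b hab hb
      by_contra hlt
      have hne : σ a ≠ σ b := fun h' => hab.ne (σ.injective h')
      have hba := lt_of_le_of_ne (not_lt.1 hlt) hne
      refine h ⟨p.succAbove a, p.succAbove b, p, by simpa, ?_, by simpa, by simp⟩
      rw [Fin.succAbove_lt_iff_castSucc_lt]
      exact hb
  · rintro ⟨h, -, hp⟩ ⟨x, y, z, hxy, hyz, h1, h2⟩
    rcases Fin.eq_self_or_eq_succAbove p x with rfl | ⟨a, rfl⟩
    · rw [insertMax_self] at h1
      exact not_lt.2 (Fin.le_last _) h1
    rcases Fin.eq_self_or_eq_succAbove p y with rfl | ⟨b, rfl⟩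
    · rw [insertMax_self] at h2
      exact not_lt.2 (Fin.le_last _) h2
    simp only [insertMax_succAbove, Fin.castSucc_lt_castSucc_iff] at h1
    rw [Fin.succAbove_lt_succAbove_iff] at hxy
    rcases Fin.eq_self_or_eq_succAbove p z with rfl | ⟨c, rfl⟩
    · rw [Fin.succAbove_lt_iff_castSucc_lt] at hyz
      exact lt_asymm h1 (hp a b hxy hyz)
    · simp only [insertMax_succAbove, Fin.castSucc_lt_castSucc_iff] at h2
      rw [Fin.succAbove_lt_succAbove_iff] at hyz
      exact h ⟨a, b, c, hxy, hyz, h1, h2⟩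

theorem insertMax_lt_last {p x : Fin (n + 1)} (σ : Perm (Fin n)) (h : x ≠ p) :
    insertMax p σ x < Fin.last n := by
  rw [Fin.lt_last_iff_ne_last, ← insertMax_self p σ]
  exact fun h' => h ((insertMax p σ).injective h')

/-- The initial increasing run after insertion has length exactly p+1: a node with run ℓ has
children with runs 1, ..., ℓ+1. -/
theorem incPrefix_insertMax {p : Fin (n + 1)} {σ : Perm (Fin n)} (hp : IncPrefix p.val σ) (j : ℕ) :
    IncPrefix j (insertMax p σ) ↔ j ≤ p.val + 1 := by
  constructor
  · rintro ⟨hj, h⟩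
    by_contra hlt
    have hb : p.val + 1 < n + 1 := by omega
    have := h p ⟨p.val + 1, hb⟩ (Fin.lt_def.2 (by simp)) (by simp; omega)
    rw [insertMax_self] at this
    exact not_lt.2 (Fin.le_last _) this
  · intro hj
    refine ⟨by omega, fun a b hab hb => ?_⟩
    have hbp : b ≤ p := by rw [Fin.le_def]; omega
    rcases Fin.eq_self_or_eq_succAbove p b with rfl | ⟨b, rfl⟩
    · rw [insertMax_self]
      exact insertMax_lt_last σ hab.ne
    rcases Fin.eq_self_or_eq_succAbove p a with rfl | ⟨a, rfl⟩
    · exact absurd hab (not_lt.2 hbp)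
    rw [Fin.succAbove_lt_succAbove_iff] at hab
    have hbp' := lt_of_le_of_ne hbp (Fin.succAbove_ne p b)
    rw [Fin.succAbove_lt_iff_castSucc_lt] at hbp'
    simpa using hp.2 a b hab hbp'

/-- Inserting at p ≠ 0 gives initial decreasing run p, while inserting at 0 lengthens the old run by
one. A node with run ℓ ≥ 1 thus again has children with runs 1, ..., ℓ+1, as for 213. -/
theorem decPrefix_insertMax {p : Fin (n + 1)} {σ : Perm (Fin n)} (hp : DecPrefix p.val σ)
    (hp0 : p ≠ 0) (j : ℕ) : DecPrefix j (insertMax p σ) ↔ j ≤ p.val := by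
  constructor
  · rintro ⟨hj, h⟩
    by_contra hlt
    have := h 0 p (Fin.pos_iff_ne_zero.2 hp0) (by omega)
    rw [insertMax_self] at this
    exact not_lt.2 (Fin.le_last _) this
  · intro hj
    refine ⟨by omega, fun a b hab hb => ?_⟩
    have hbp : b < p := by rw [Fin.lt_def]; omega
    rcases Fin.eq_self_or_eq_succAbove p b with rfl | ⟨b, rfl⟩
    · exact absurd hbp (lt_irrefl _)
    rcases Fin.eq_self_or_eq_succAbove p a with rfl | ⟨a, rfl⟩
    · exact absurd hab (lt_asymm hbp)
    rw [Fin.succAbove_lt_succAbove_iff] at hab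
    rw [Fin.succAbove_lt_iff_castSucc_lt] at hbp
    simpa using hp.2 a b hab hbp

theorem decPrefix_insertMax_zero (σ : Perm (Fin n)) (j : ℕ) :
    DecPrefix j (insertMax 0 σ) ↔ DecPrefix (j - 1) σ := by
  constructor
  · rintro ⟨hj, h⟩
    refine ⟨by omega, fun a b hab hb => ?_⟩
    have := h (Fin.succAbove 0 a) (Fin.succAbove 0 b) (by simpa) (by simp; omega)
    rwa [insertMax_succAbove, insertMax_succAbove, Fin.castSucc_lt_castSucc_iff] at this
  · rintro ⟨hj, h⟩
    by_cases hj0 : j = 0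
    · exact ⟨by omega, fun a b _ hb => by omega⟩
    refine ⟨by omega, fun a b hab hb => ?_⟩
    rcases Fin.eq_self_or_eq_succAbove 0 b with rfl | ⟨b, rfl⟩
    · exact absurd hab (by simp)
    rcases Fin.eq_self_or_eq_succAbove 0 a with rfl | ⟨a, rfl⟩
    · rw [insertMax_self]
      exact insertMax_lt_last σ hab.ne'
    rw [Fin.succAbove_lt_succAbove_iff] at hab
    rw [insertMax_succAbove, insertMax_succAbove, Fin.castSucc_lt_castSucc_iff]
    exact h a b hab (by simp at hb; omega)

theorem card_incPrefix_succ (j : ℕ) :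
    Nat.card {π : Perm (Fin (n + 1)) // ¬ HasPattern p213 π ∧ IncPrefix j π} =
      ∑ p ∈ Finset.range (n + 1), if j ≤ p + 1 then
        Nat.card {σ : Perm (Fin n) // ¬ HasPattern p213 σ ∧ IncPrefix p σ} else 0 := by
  rw [card_perm_succ, Finset.sum_range]
  refine Finset.sum_congr rfl fun p _ => ?_
  simp only [not_hasPattern_p213_insertMax]
  split_ifs with hj
  · refine Nat.card_congr (Equiv.subtypeEquivRight fun σ => ?_)
    exact ⟨fun h => h.1, fun h => ⟨h, (incPrefix_insertMax h.2 j).2 hj⟩⟩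
  · rw [Nat.card_eq_zero]
    exact Or.inl ⟨fun σ => hj ((incPrefix_insertMax σ.2.1.2 j).1 σ.2.2)⟩

/-- Same recursion as for `IncPrefix`, but the term p = j-1 of that sum arises here from insertion
at position 0. -/
theorem card_decPrefix_succ (j : ℕ) :
    Nat.card {π : Perm (Fin (n + 1)) // ¬ HasPattern p123 π ∧ DecPrefix j π} =
      ∑ p ∈ Finset.range (n + 1), if j ≤ p + 1 then
        Nat.card {σ : Perm (Fin n) // ¬ HasPattern p123 σ ∧ DecPrefix p σ} else 0 := by
  set W : ℕ → ℕ := fun p => Nat.card {σ : Perm (Fin n) // ¬ HasPattern p123 σ ∧ DecPrefix p σ}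
    with hW
  have h : Nat.card {π : Perm (Fin (n + 1)) // ¬ HasPattern p123 π ∧ DecPrefix j π} =
      ∑ p ∈ Finset.range (n + 1), if p = 0 then W (j - 1) else if j ≤ p then W p else 0 := by
    rw [card_perm_succ, Finset.sum_range]
    refine Finset.sum_congr rfl fun p _ => ?_
    simp only [not_hasPattern_p123_insertMax]
    split_ifs with hp hj
    · obtain rfl : p = 0 := Fin.ext hp
      refine Nat.card_congr (Equiv.subtypeEquivRight fun σ => ?_)
      rw [decPrefix_insertMax_zero]
      exact ⟨fun h => ⟨h.1.1, h.2⟩, fun h => ⟨⟨h.1, by simp, fun a b _ hb => by simp at hb⟩, h.2⟩⟩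
    · refine Nat.card_congr (Equiv.subtypeEquivRight fun σ => ?_)
      have hp' : p ≠ 0 := fun h => hp (by simp [h])
      exact ⟨fun h => h.1, fun h => ⟨h, (decPrefix_insertMax h.2 hp' j).2 hj⟩⟩
    · rw [Nat.card_eq_zero]
      have hp' : p ≠ 0 := fun h => hp (by simp [h])
      exact Or.inl ⟨fun σ => hj ((decPrefix_insertMax σ.2.1.2 hp' j).1 σ.2.2)⟩
  rw [h]
  change _ = ∑ p ∈ Finset.range (n + 1), if j ≤ p + 1 then W p else 0
  have hzero : ∀ p, n < p → W p = 0 := by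
    intro p hp
    rw [hW, Nat.card_eq_zero]
    exact Or.inl ⟨fun σ => not_lt.2 σ.2.2.1 hp⟩
  -- For j < 2 truncated subtraction gives j - 1 = 0, so the sums agree termwise. For j ≥ 2 the term
  -- `W (j - 1)` moves from index 0 to index j - 1, and vanishes if that index exceeds n.
  rcases Nat.lt_or_ge j 2 with hj | hj
  · refine Finset.sum_congr rfl fun p _ => ?_
    by_cases hp : p = 0
    · subst hp
      rw [if_pos rfl, if_pos (by omega), show j - 1 = 0 by omega]
    · rw [if_neg hp, if_pos (by omega), if_pos (by omega)]
  · have h1 : ∀ p, (if p = 0 then W (j - 1) else if j ≤ p then W p else 0) =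
        (if p = 0 then W (j - 1) else 0) + if j ≤ p then W p else 0 := by
      intro p
      split_ifs <;> omega
    have h2 : ∀ p, (if j ≤ p + 1 then W p else 0) =
        (if p = j - 1 then W (j - 1) else 0) + if j ≤ p then W p else 0 := by
      intro p
      split_ifs with h1 h2 h3 <;> first | omega | simp [h2]
    simp only [h1, h2, Finset.sum_add_distrib, Finset.sum_ite_eq', Finset.mem_range]
    rw [if_pos (by omega)]
    split_ifs with h3
    · rfl
    · rw [hzero _ (by omega)]

theorem card_incPrefix_eq_card_decPrefix (n j : ℕ) :
    Nat.card {π : Perm (Fin n) // ¬ HasPattern p213 π ∧ IncPrefix j π} =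
      Nat.card {π : Perm (Fin n) // ¬ HasPattern p123 π ∧ DecPrefix j π} := by
  induction n generalizing j with
  | zero =>
    refine Nat.card_congr (Equiv.subtypeEquivRight fun π => ?_)
    simp [hasPattern_p213, hasPattern_p123, IncPrefix, DecPrefix]
  | succ n ih =>
    rw [card_incPrefix_succ, card_decPrefix_succ]
    exact Finset.sum_congr rfl fun p _ => by rw [ih]

theorem avoidCount_p213_eq_p123 (n : ℕ) : avoidCount p213 n = avoidCount p123 n := by
  have h := card_incPrefix_eq_card_decPrefix n 0
  simpa [IncPrefix, DecPrefix, avoidCount] using h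

end InsertMax

/-! ### Reversal, reverse-complement and inversion -/

section Symmetry

variable {n : ℕ}

theorem hasPattern_p321_mul_revPerm (π : Perm (Fin n)) :
    HasPattern p321 (π * Fin.revPerm) ↔ HasPattern p123 π := by
  rw [hasPattern_p321, hasPattern_p123]
  constructor
  · rintro ⟨x, y, z, hxy, hyz, h1, h2⟩
    exact ⟨z.rev, y.rev, x.rev, by simpa, by simpa, by simpa using h1, by simpa using h2⟩
  · rintro ⟨x, y, z, hxy, hyz, h1, h2⟩
    exact ⟨z.rev, y.rev, x.rev, by simpa, by simpa, by simpa using h1, by simpa using h2⟩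

theorem avoidCount_p123_eq_p321 (n : ℕ) : avoidCount p123 n = avoidCount p321 n :=
  Nat.card_congr ((Equiv.mulRight Fin.revPerm).subtypeEquiv fun π => by
    rw [Equiv.coe_mulRight, hasPattern_p321_mul_revPerm])

theorem hasPattern_p213_permCongr_revPerm (π : Perm (Fin n)) :
    HasPattern p213 (Fin.revPerm.permCongr π) ↔ HasPattern p132 π := by
  rw [hasPattern_p213, hasPattern_p132]
  constructor
  · rintro ⟨x, y, z, hxy, hyz, h1, h2⟩
    exact ⟨z.rev, y.rev, x.rev, by simpa, by simpa, by simpa using h2, by simpa using h1⟩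
  · rintro ⟨x, y, z, hxy, hyz, h1, h2⟩
    exact ⟨z.rev, y.rev, x.rev, by simpa, by simpa, by simpa using h2, by simpa using h1⟩

theorem avoidCount_p132_eq_p213 (n : ℕ) : avoidCount p132 n = avoidCount p213 n :=
  Nat.card_congr (Fin.revPerm.permCongr.subtypeEquiv fun π => by
    rw [hasPattern_p213_permCongr_revPerm])

theorem s_p132_eq_p213 (n k : ℕ) : s n k {p132} = s n k {p213} := by
  rw [s_singleton, s_singleton]
  exact Nat.card_congr (Fin.revPerm.permCongr.subtypeEquiv fun π => by
    rw [hasPattern_p213_permCongr_revPerm, fixCount_permCongr])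

theorem hasPattern_p312_inv (π : Perm (Fin n)) :
    HasPattern p312 π⁻¹ ↔ HasPattern p231 π := by
  rw [hasPattern_p312, hasPattern_p231]
  constructor
  · rintro ⟨x, y, z, hxy, hyz, h1, h2⟩
    exact ⟨π⁻¹ y, π⁻¹ z, π⁻¹ x, h1, h2, by simpa, by simpa⟩
  · rintro ⟨x, y, z, hxy, hyz, h1, h2⟩
    exact ⟨π z, π x, π y, h1, h2, by simpa, by simpa⟩

theorem fixCount_inv {X : Type*} (π : Perm X) : fixCount π⁻¹ = fixCount π :=
  Nat.card_congr (Equiv.subtypeEquivRight fun x => by rw [Perm.inv_eq_iff_eq, eq_comm])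

theorem s_p231_eq_p312 (n k : ℕ) : s n k {p231} = s n k {p312} := by
  rw [s_singleton, s_singleton]
  exact Nat.card_congr ((Equiv.inv (Perm (Fin n))).subtypeEquiv fun π => by
    rw [Equiv.inv_apply, hasPattern_p312_inv, fixCount_inv])

theorem s_p132_eq_p321 (n k : ℕ) : s n k {p132} = s n k {p321} :=
  s_eq_of_recurrence
    (fun n => by rw [avoidCount_p132_eq_p213, avoidCount_p213_eq_p123, avoidCount_p123_eq_p321])
    avoidGeCount_p132_succ avoidGeCount_p321_succ n k

end Symmetry

/-! ### Many fixed points: the cases h ≥ 3 -/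

section FewMovedPoints

theorem s_p123_eq_zero {k : ℕ} (hk : 3 ≤ k) (n : ℕ) : s n k {p123} = 0 := by
  rw [s_singleton, Nat.card_eq_zero]
  refine Or.inl ⟨fun ⟨π, hπ, hfix⟩ => hπ ?_⟩
  rw [← numFixed_eq_fixCount, numFixed] at hfix
  obtain ⟨t, ht, hcard⟩ := Finset.exists_subset_card_eq (hk.trans hfix.ge)
  have hmem : ∀ a, π (t.orderEmbOfFin hcard a) = t.orderEmbOfFin hcard a := fun a =>
    (Finset.mem_filter.1 (ht (t.orderEmbOfFin_mem hcard a))).2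
  refine ⟨t.orderEmbOfFin hcard, (t.orderEmbOfFin hcard).strictMono, fun a b => ?_⟩
  rw [hmem, hmem, OrderEmbedding.lt_iff_lt]
  revert a b
  decide

theorem fixCount_add_card_support {n : ℕ} (π : Perm (Fin n)) :
    fixCount π + π.support.card = n := by
  have h : (Finset.univ.filter fun i => π i = i) = π.supportᶜ := by
    ext x
    simp
  rw [← numFixed_eq_fixCount, numFixed, h, Finset.card_compl_add_card, Fintype.card_fin]

theorem fixCount_eq_iff_isSwap {k : ℕ} (π : Perm (Fin (k + 2))) :
    fixCount π = k ↔ π.IsSwap := by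
  rw [← Perm.card_support_eq_two]
  have := fixCount_add_card_support π
  omega

theorem swap_inj_of_lt {X : Type*} [LinearOrder X] {a b c d : X} (hab : a < b) (hcd : c < d)
    (h : swap a b = swap c d) : a = c ∧ b = d := by
  have h1 := congrArg (fun π => π a) h
  have h2 := congrArg (fun π => π c) h
  simp only [swap_apply_def] at h1 h2
  grind

theorem hasPattern_p132_swap_iff {n : ℕ} {a b : Fin (n + 1)} (hab : a < b) :
    ¬ HasPattern p132 (swap a b) ↔ a = 0 := by
  rw [hasPattern_p132]
  constructor
  · intro h
    by_contra ha
    have ha' : 0 < a := Fin.pos_iff_ne_zero.2 ha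
    refine h ⟨0, a, b, ha', hab, ?_, ?_⟩
    · rw [swap_apply_right, swap_apply_of_ne_of_ne ha'.ne (ha'.trans hab).ne]
      exact ha'
    · rw [swap_apply_right, swap_apply_left]
      exact hab
  · rintro rfl ⟨x, y, z, hxy, hyz, h1, h2⟩
    simp only [swap_apply_def] at h1 h2
    grind

/-- A 312 in a transposition would need two points strictly between a and b to serve as "1" and "2";
the bound leaves room for at most one. -/
theorem not_hasPattern_p312_swap {n : ℕ} {a b : Fin n} (hb : b.val ≤ a.val + 2) (hab : a < b) :
    ¬ HasPattern p312 (swap a b) := by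
  rw [hasPattern_p312]
  rintro ⟨x, y, z, hxy, hyz, h1, h2⟩
  simp only [swap_apply_def] at h1 h2
  simp only [Fin.lt_def] at *
  split_ifs at h1 h2 <;> simp_all [Fin.ext_iff] <;> omega

theorem s_p132_add_two (k : ℕ) : s (k + 2) k {p132} = k + 1 := by
  rw [s_singleton]
  trans Nat.card (Fin (k + 1))
  · symm
    refine Nat.card_congr (Equiv.ofBijective (fun b => ⟨swap 0 b.succ,
      (hasPattern_p132_swap_iff b.succ_pos).2 rfl,
      (fixCount_eq_iff_isSwap _).2 ⟨0, b.succ, b.succ_pos.ne, rfl⟩⟩) ⟨?_, ?_⟩)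
    · intro b c h
      exact Fin.succ_injective _
        (swap_inj_of_lt b.succ_pos c.succ_pos (congrArg Subtype.val h)).2
    · rintro ⟨π, hπ, hfix⟩
      obtain ⟨a, b, hab, rfl⟩ := (fixCount_eq_iff_isSwap _).1 hfix
      wlog hlt : a < b generalizing a b with H
      · obtain ⟨c, hc⟩ := H b a hab.symm (by rwa [swap_comm]) (by rwa [swap_comm])
          (lt_of_le_of_ne (not_lt.1 hlt) hab.symm)
        exact ⟨c, hc.trans (Subtype.ext (swap_comm _ _))⟩
      obtain rfl := (hasPattern_p132_swap_iff hlt).1 hπ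
      obtain ⟨c, rfl⟩ := Fin.exists_succ_eq.2 hlt.ne'
      exact ⟨c, rfl⟩
  · simp

theorem le_s_p312_add_two (k : ℕ) : 2 * k + 1 ≤ s (k + 2) k {p312} := by
  rw [s_singleton]
  have h1 : ∀ b : Fin (k + 1), b.castSucc < b.succ := fun b => Fin.castSucc_lt_succ
  have h2 : ∀ b : Fin k, b.castSucc.castSucc < b.succ.succ := fun b => by
    rw [Fin.lt_def]
    simp
  -- The k+1 transpositions at distance 1 and the k at distance 2 give the bound 2k+1.
  let f : Fin (k + 1) ⊕ Fin k →
      {π : Perm (Fin (k + 2)) // ¬ HasPattern p312 π ∧ fixCount π = k} := Sum.elim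
    (fun b => ⟨swap b.castSucc b.succ, not_hasPattern_p312_swap (by simp) (h1 b),
      (fixCount_eq_iff_isSwap _).2 ⟨_, _, (h1 b).ne, rfl⟩⟩)
    (fun b => ⟨swap b.castSucc.castSucc b.succ.succ, not_hasPattern_p312_swap (by simp) (h2 b),
      (fixCount_eq_iff_isSwap _).2 ⟨_, _, (h2 b).ne, rfl⟩⟩)
  have hf : Function.Injective f := by
    rintro (b | b) (c | c) h
    · have := swap_inj_of_lt (h1 b) (h1 c) (congrArg Subtype.val h)
      simpa using this.1
    · have := swap_inj_of_lt (h1 b) (h2 c) (congrArg Subtype.val h)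
      simp only [Fin.ext_iff, Fin.val_castSucc, Fin.val_succ] at this
      omega
    · have := swap_inj_of_lt (h2 b) (h1 c) (congrArg Subtype.val h)
      simp only [Fin.ext_iff, Fin.val_castSucc, Fin.val_succ] at this
      omega
    · have := swap_inj_of_lt (h2 b) (h2 c) (congrArg Subtype.val h)
      simpa using this.1
  have := Nat.card_le_card_of_injective f hf
  rw [Nat.card_eq_fintype_card, Fintype.card_sum, Fintype.card_fin, Fintype.card_fin] at this
  omega

end FewMovedPoints

/-! ### Values at n = 5 by kernel computation -/

section SmallValues

theorem s_eq_card_filter {n k : ℕ} {α : Perm (Fin 3)} {P : Perm (Fin n) → Prop} [DecidablePred P]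
    (hP : ∀ π, HasPattern α π ↔ P π) :
    s n k {α} = (Finset.univ.filter fun π => ¬ P π ∧ numFixed π = k).card := by
  rw [s_singleton, ← Fintype.card_subtype, ← Nat.card_eq_fintype_card]
  exact Nat.card_congr (Equiv.subtypeEquivRight fun π => by rw [hP, numFixed_eq_fixCount])

theorem s_five_p123 : s 5 1 {p123} = 20 ∧ s 5 2 {p123} = 2 := by
  rw [s_eq_card_filter hasPattern_p123, s_eq_card_filter hasPattern_p123]
  decide +kernel

theorem s_five_p231 : s 5 1 {p231} = 16 ∧ s 5 2 {p231} = 8 := by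
  rw [s_eq_card_filter hasPattern_p231, s_eq_card_filter hasPattern_p231]
  decide +kernel

theorem s_five_p132 : s 5 1 {p132} = 13 ∧ s 5 2 {p132} = 6 := by
  rw [s_eq_card_filter hasPattern_p132, s_eq_card_filter hasPattern_p132]
  decide +kernel

end SmallValues

/-! ### Assembling the Wilf classes -/

section Classes

theorem perm_fin_three_cases : ∀ α : Perm (Fin 3),
    α = p123 ∨ α = p132 ∨ α = p213 ∨ α = p231 ∨ α = p312 ∨ α = p321 := by
  decide

theorem exists_s_pairwise_ne {h : ℕ} (hh : 0 < h) : ∃ n, 3 ≤ n ∧ h ≤ n ∧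
    s n h {p123} ≠ s n h {p132} ∧ s n h {p123} ≠ s n h {p231} ∧ s n h {p132} ≠ s n h {p231} := by
  obtain rfl | rfl | h3 : h = 1 ∨ h = 2 ∨ 3 ≤ h := by omega
  · refine ⟨5, by norm_num, by norm_num, ?_⟩
    rw [s_five_p123.1, s_five_p231.1, s_five_p132.1]
    decide
  · refine ⟨5, by norm_num, by norm_num, ?_⟩
    rw [s_five_p123.2, s_five_p231.2, s_five_p132.2]
    decide
  · refine ⟨h + 2, by omega, by omega, ?_⟩
    rw [s_p123_eq_zero h3, s_p132_add_two, s_p231_eq_p312]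
    have := le_s_p312_add_two h
    omega

/-- Representative of the class of a pattern of length three. -/
def wilfRep (α : Perm (Fin 3)) : Perm (Fin 3) :=
  if α = p123 then p123 else if α = p231 ∨ α = p312 then p231 else p132

theorem s_eq_s_wilfRep (n h : ℕ) (α : Perm (Fin 3)) : s n h {α} = s n h {wilfRep α} := by
  have e1 : wilfRep p123 = p123 := by decide
  have e2 : wilfRep p132 = p132 := by decide
  have e3 : wilfRep p213 = p132 := by decide
  have e4 : wilfRep p231 = p231 := by decide
  have e5 : wilfRep p312 = p231 := by decide
  have e6 : wilfRep p321 = p132 := by decide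
  rcases perm_fin_three_cases α with rfl | rfl | rfl | rfl | rfl | rfl
  · rw [e1]
  · rw [e2]
  · rw [e3, s_p132_eq_p213]
  · rw [e4]
  · rw [e5, s_p231_eq_p312]
  · rw [e6, s_p132_eq_p321]

theorem hWilf_iff {h : ℕ} (hh : 0 < h) (α β : Perm (Fin 3)) :
    hWilf h 3 α β ↔ wilfRep α = wilfRep β := by
  constructor
  · intro H
    obtain ⟨n, hn, hhn, h1, h2, h3⟩ := exists_s_pairwise_ne hh
    have H' : s n h {α} = s n h {β} := H n hn hhn
    rw [s_eq_s_wilfRep, s_eq_s_wilfRep n h β] at H'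
    have hr : ∀ α, wilfRep α = p123 ∨ wilfRep α = p132 ∨ wilfRep α = p231 := by decide
    rcases hr α with ha | ha | ha <;> rcases hr β with hb | hb | hb <;> rw [ha, hb] at H' ⊢
    · exact absurd H' h1
    · exact absurd H' h2
    · exact absurd H' h1.symm
    · exact absurd H' h3
    · exact absurd H' h2.symm
    · exact absurd H' h3.symm
  · intro H n _ _
    rw [s_eq_s_wilfRep, s_eq_s_wilfRep n h β, H]

theorem classes_hWilf_three {h : ℕ} (hh : 0 < h) :
    (hWilf h 3).classes = {{p123}, {p132, p213, p321}, {p231, p312}} := by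
  have hcl : ∀ β : Perm (Fin 3), {α | hWilf h 3 α β} = {α | wilfRep α = wilfRep β} := by
    intro β
    ext α
    exact hWilf_iff hh α β
  have c1 : {α | wilfRep α = p123} = {p123} := by
    ext α
    simp only [Set.mem_ofPred_eq, Set.mem_singleton_iff]
    revert α
    decide
  have c2 : {α | wilfRep α = p132} = {p132, p213, p321} := by
    ext α
    simp only [Set.mem_ofPred_eq, Set.mem_singleton_iff, Set.mem_insert_iff]
    revert α
    decide
  have c3 : {α | wilfRep α = p231} = {p231, p312} := by
    ext α
    simp only [Set.mem_ofPred_eq, Set.mem_singleton_iff, Set.mem_insert_iff]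
    revert α
    decide
  have hr : ∀ β, wilfRep β = p123 ∨ wilfRep β = p132 ∨ wilfRep β = p231 := by decide
  rw [← c1, ← c2, ← c3]
  ext S
  simp only [Setoid.classes, Set.mem_ofPred_eq, Set.mem_singleton_iff, Set.mem_insert_iff, hcl]
  constructor
  · rintro ⟨β, rfl⟩
    rcases hr β with hb | hb | hb <;> simp [hb]
  · rintro (rfl | rfl | rfl)
    · exact ⟨p123, rfl⟩
    · exact ⟨p132, rfl⟩
    · exact ⟨p231, rfl⟩

theorem ncard_classes_hWilf_three {h : ℕ} (hh : 0 < h) : (hWilf h 3).classes.ncard = 3 := by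
  rw [classes_hWilf_three hh, Set.ncard_eq_three]
  have h12 : p123 ≠ p132 := by decide
  have h14 : p123 ≠ p231 := by decide
  have h24 : p132 ≠ p231 := by decide
  have h25 : p132 ≠ p312 := by decide
  refine ⟨_, _, _, ?_, ?_, ?_, rfl⟩
  · intro H
    have : p132 ∈ ({p123} : Set (Perm (Fin 3))) := by rw [H]; simp
    exact h12 (Set.mem_singleton_iff.1 this).symm
  · intro H
    have : p231 ∈ ({p123} : Set (Perm (Fin 3))) := by rw [H]; simp
    exact h14 (Set.mem_singleton_iff.1 this).symm
  · intro H
    have : p132 ∈ ({p231, p312} : Set (Perm (Fin 3))) := by rw [← H]; simp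
    rcases this with h' | h'
    · exact h24 h'
    · exact h25 h'

end Classes

end PatternAvoid

open PatternAvoid in
theorem theorem6p3 :
    (∀ h : ℕ, 0 < h →
      (hWilf h 3).classes.ncard = 3 ∧
      (hWilf h 3).classes = {{p123}, {p132, p213, p321}, {p231, p312}} ∧
      (∀ n : ℕ, s n h {p132} = s n h {p213} ∧ s n h {p213} = s n h {p321} ∧
        s n h {p231} = s n h {p312})) ∧
    (s 5 1 {p123} = 20 ∧ s 5 1 {p231} = 16 ∧ s 5 1 {p132} = 13) ∧
    (s 5 2 {p123} = 2 ∧ s 5 2 {p231} = 8 ∧ s 5 2 {p132} = 6) ∧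
    (∀ h : ℕ, 3 ≤ h →
      (∀ n : ℕ, s n h {p123} = 0) ∧
      s (h + 2) h {p132} = h + 1 ∧
      2 * h + 1 ≤ s (h + 2) h {p312}) := by
  refine ⟨fun h hh => ⟨ncard_classes_hWilf_three hh, classes_hWilf_three hh, fun n =>
      ⟨s_p132_eq_p213 n h, (s_p132_eq_p213 n h).symm.trans (s_p132_eq_p321 n h),
        s_p231_eq_p312 n h⟩⟩,
    ⟨s_five_p123.1, s_five_p231.1, s_five_p132.1⟩,
    ⟨s_five_p123.2, s_five_p231.2, s_five_p132.2⟩,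
    fun h hh => ⟨s_p123_eq_zero hh, s_p132_add_two h, le_s_p312_add_two h⟩⟩
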